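/- **Uniqueness of the solution.** Let $\alpha\in(0,1)$, $\theta<1$, $0\le a<T<\infty$, $p=1-\theta$, and let $\beta\in(0,2)$, $\beta\neq 1$. Put $Av=-(x^{\beta}v')'$ and $\Omega=(0,1)\times(a,T]$. Let $$D_t\,g(t)=p^{\alpha}t^{-p\alpha}\Big(1-\alpha+\frac tp\frac{d}{dt}\Big)\Big[\frac{t^{-p(1-\alpha)}}{\Gamma(1-\alpha)}\int_a^t (t^p-\tau^p)^{-\alpha}g(\tau)\,d(\tau^p)\Big]-\frac{p^{\alpha}\,g(a)\,(t^p-a^p)^{-\alpha}}{\Gamma(1-\alpha)},\qquad a<t\le T,$$ be the regularized Caputo-like counterpart of the hyper-Bessel operator of order $\alpha$ with starting point $a$. Consider the mixed problem $$D_t u-\frac{\partial}{\partial x}\Big(x^{\beta}\frac{\partial u}{\partial x}\Big)=f\ \text{ in }\Omega,\qquad u(x,a+)=\varphi(x)\ (0\le x\le1),\qquad u(1,t)=0\ (a\le t\le T),$$ with, when $0<\beta<1$, the additional condition $u(0,t)=0$ for $a\le t\le T$ (no condition at $x=0$ when $1<\beta<2$). 1. Let $0<\beta<1$. For all functions $f$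 and $\varphi$ the problem has at most one classical solution: if $u_1,u_2\in C(\overline\Omega)$, with $D_tu_i$ and $Au_i$ existing and continuous in $\Omega$, both satisfy the equation, the initial condition and the boundary conditions, then $u_1=u_2$ on $\overline\Omega=[0,1]\times[a,T]$. 2. Let $1<\beta<2$. Let $\dot W=\dot W^{1}_{2,\beta}(0,1)$ be the closure, in the norm $\big(\int_0^1 (v^2+x^{\beta}v'^2)\,dx\big)^{1/2}$, of the set $D(A)$ of all $v\in C[0,1]$ with $x^{\beta}v'\in C[0,1]$, $(x^{\beta}v')'\in AC[0,1]$ and $v(1)=0$, and denote the Friedrichs extension of $A|_{D(A)}$ in $L^2(0,1)$ again by $A$. For every $f:(a,T]\to L^2(0,1)$ and every $\varphi\in L^2(0,1)$ the problem has at most one weak solution. Here a weak solution is a function $u\in C([a,T],L^2(0,1))\cap C((a,T],\dot W)$ with $Au\in C((a,T],L^2(0,1))$ such that $u(\cdot,t)\to\varphi$ in $L^2(0,1)$ as $t\to a+$ and, for all $\omega\in\dot W$ and $t\in(a,T]$, the derivative $D_t(u,\omega)_{L^2(0,1)}$ exists and $$D_t\,(u,\omega)_{L^2(0,1)}+\int_0^1x^{\beta}\,\frac{\partial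 u}{\partial x}\,\omega'\,dx=(f,\omega)_{L^2(0,1)} .$$ That is, any two weak solutions $u_1,u_2$ with the same data satisfy $u_1(\cdot,t)=u_2(\cdot,t)$ in $L^2(0,1)$ for all $t\in[a,T]$. -/

import Mathlib

open MeasureTheory Set Filter Topology

noncomputable section

namespace DegenerateFractional

/-- The Erdelyi-Kober fractional integral with starting point `a`,
`t ^ (-b (γ + δ)) / Γ(δ) * ∫_a^t (t ^ b - τ ^ b) ^ (δ - 1) τ ^ (b γ) g(τ) d(τ ^ b)`,
where `d(τ ^ b) = b τ ^ (b - 1) dτ`. -/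
def ekIntegral (b γ δ a : ℝ) (g : ℝ → ℝ) (t : ℝ) : ℝ :=
  t ^ (-b * (γ + δ)) / Real.Gamma δ *
    ∫ τ in a..t, (t ^ b - τ ^ b) ^ (δ - 1) * τ ^ (b * γ) * g τ * (b * τ ^ (b - 1))

/-- The Erdelyi-Kober fractional derivative of order `0 < δ < 1` on `(a, T]`,
`(γ + 1 + (t / b) d/dt)` applied to the Erdelyi-Kober integral with parameters `γ + δ`, `1 - δ`
(the derivative at `t = T` is the one from the left). -/
def ekDeriv (b γ δ a T : ℝ) (g : ℝ → ℝ) (t : ℝ) : ℝ :=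
  (γ + 1) * ekIntegral b (γ + δ) (1 - δ) a g t +
    t / b * derivWithin (ekIntegral b (γ + δ) (1 - δ) a g) (Ioc a T) t

/-- The hyper-Bessel fractional differential operator of order `0 < α < 1`, for `θ < 1`:
`(1 - θ) ^ α t ^ (-(1 - θ) α) I^{0, -α}`, where `I^{0, -α}`, the Erdelyi-Kober integral of
negative order, stands for the Erdelyi-Kober derivative `D^{-α, α}`. -/
def hyperBessel (α θ a T : ℝ) (g : ℝ → ℝ) (t : ℝ) : ℝ :=
  (1 - θ) ^ α * t ^ (-(1 - θ) * α) * ekDeriv (1 - θ) (-α) α a T g t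

/-- The regularized Caputo-like counterpart of the hyper-Bessel operator on `(a, T]`. -/
def caputoHyperBessel (α θ a T : ℝ) (g : ℝ → ℝ) (t : ℝ) : ℝ :=
  hyperBessel α θ a T g t -
    g a * (t ^ (1 - θ) - a ^ (1 - θ)) ^ (-α) / ((1 - θ) ^ (-α) * Real.Gamma (1 - α))

/-- The hyper-Bessel derivative (equivalently, its Caputo-like counterpart) of `g` exists at every
point of `(a, T]`: the function differentiated in `ekDeriv` is differentiable there. -/
def HasHyperBessel (α θ a T : ℝ) (g : ℝ → ℝ) : Prop :=
  DifferentiableOn ℝ (ekIntegral (1 - θ) (-α + α) (1 - α) a g) (Ioc a T)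

/-- The differential expression `A v = -(x ^ β v')'`. -/
def opA (β : ℝ) (v : ℝ → ℝ) (x : ℝ) : ℝ :=
  -deriv (fun y => y ^ β * deriv v y) x

/-- `u` is a classical solution of
`ᶜ((t - a) ^ θ ∂_t) ^ α u - ∂_x (x ^ β ∂_x u) = f` in `(0, 1) × (a, T]`, `u(x, a+) = φ(x)`,
`u(1, t) = 0` and, when `β < 1`, also `u(0, t) = 0`. -/
structure IsClassicalSolution (α θ β a T : ℝ) (f : ℝ → ℝ → ℝ) (φ : ℝ → ℝ)
    (u : ℝ → ℝ → ℝ) : Prop where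
  continuousOn : ContinuousOn (fun z : ℝ × ℝ => u z.1 z.2) (Icc 0 1 ×ˢ Icc a T)
  time_exists : ∀ x ∈ Ioo (0 : ℝ) 1, HasHyperBessel α θ a T (u x)
  time_continuousOn : ContinuousOn
    (fun z : ℝ × ℝ => caputoHyperBessel α θ a T (u z.1) z.2) (Ioo 0 1 ×ˢ Ioc a T)
  space_exists : ∀ t ∈ Ioc a T, ∀ x ∈ Ioo (0 : ℝ) 1,
    DifferentiableAt ℝ (fun y => u y t) x ∧
      DifferentiableAt ℝ (fun y => y ^ β * deriv (fun y' => u y' t) y) x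
  space_continuousOn : ContinuousOn
    (fun z : ℝ × ℝ => opA β (fun y => u y z.2) z.1) (Ioo 0 1 ×ˢ Ioc a T)
  equation : ∀ x ∈ Ioo (0 : ℝ) 1, ∀ t ∈ Ioc a T,
    caputoHyperBessel α θ a T (u x) t + opA β (fun y => u y t) x = f x t
  initial : ∀ x ∈ Icc (0 : ℝ) 1, Tendsto (u x) (𝓝[>] a) (𝓝 (φ x))
  boundary_left : β < 1 → ∀ t ∈ Icc a T, u 0 t = 0
  boundary_right : ∀ t ∈ Icc a T, u 1 t = 0

/-- The real Hilbert space `L²(0, 1)`. -/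
abbrev L2 : Type := Lp ℝ 2 (volume.restrict (Ioo (0 : ℝ) 1))

/-- The domain `D(A)`: `v ∈ C[0, 1]`, `x ^ β v' ∈ C[0, 1]` (this is `w`), `(x ^ β v')' ∈ AC[0, 1]`
(this is `z`; in particular `A v = -z ∈ L²(0, 1)`), `v(1) = 0` and, when `β < 1`, `v(0) = 0`. -/
structure MemDomainA (β : ℝ) (v : ℝ → ℝ) : Prop where
  continuousOn : ContinuousOn v (Icc 0 1)
  differentiableAt : ∀ x ∈ Ioo (0 : ℝ) 1, DifferentiableAt ℝ v x
  flux : ∃ w z : ℝ → ℝ, ContinuousOn w (Icc 0 1) ∧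
    (∀ x ∈ Ioo (0 : ℝ) 1, w x = x ^ β * deriv v x) ∧
    (∀ x ∈ Ioo (0 : ℝ) 1, HasDerivAt w (z x) x) ∧
    AbsolutelyContinuousOnInterval z 0 1
  boundary_left : β < 1 → v 0 = 0
  boundary_right : v 1 = 0

/-- The pairs `(v, x ^ (β / 2) v')` in `L²(0, 1) × L²(0, 1)` with `v ∈ D(A)`. -/
def domainGraph (β : ℝ) : Set (L2 × L2) :=
  {p | ∃ v : ℝ → ℝ, MemDomainA β v ∧
    (p.1 =ᵐ[volume.restrict (Ioo (0 : ℝ) 1)] v) ∧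
    (p.2 =ᵐ[volume.restrict (Ioo (0 : ℝ) 1)] fun x => x ^ (β / 2) * deriv v x)}

/-- The weighted space `W`, the closure of `D(A)` in the norm
`(∫ v² + x ^ β v'²) ^ (1 / 2)`. An element `v` is recorded together with its weighted derivative,
as the pair `(v, x ^ (β / 2) v')`; the second component is determined by the first, and the norm
of `W` is equivalent to the norm of the pair in `L² × L²`. -/
def weightedSobolev (β : ℝ) : Set (L2 × L2) := closure (domainGraph β)

/-- `u` is a weak solution of the problem with data `f`, `φ`. Here `d t` is the weighted derivative
`x ^ (β / 2) ∂_x u(·, t)`, and `g t` is `A u(·, t)`, for the Friedrichs extension of `A`, which is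
the operator of the form `∫ x ^ β v' ω'` on `W`. -/
structure IsWeakSolution (α θ β a T : ℝ) (f : ℝ → L2) (φ : L2) (u : ℝ → L2) : Prop where
  continuousOn : ContinuousOn u (Icc a T)
  initial : Tendsto u (𝓝[>] a) (𝓝 φ)
  weak : ∃ d g : ℝ → L2,
    (∀ t ∈ Ioc a T, (u t, d t) ∈ weightedSobolev β) ∧
    ContinuousOn d (Ioc a T) ∧
    (∀ t ∈ Ioc a T, ∀ ω ∈ weightedSobolev β, inner ℝ (d t) ω.2 = inner ℝ (g t) ω.1) ∧
    ContinuousOn g (Ioc a T) ∧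
    ∀ ω ∈ weightedSobolev β,
      HasHyperBessel α θ a T (fun t => inner ℝ (u t) ω.1) ∧
      ∀ t ∈ Ioc a T,
        caputoHyperBessel α θ a T (fun s => inner ℝ (u s) ω.1) t + inner ℝ (d t) ω.2 =
          inner ℝ (f t) ω.1

end DegenerateFractional

end

/-! Both parts rest on an extremum principle in time. In the variable `s = t ^ (1 - θ)`, the
hyper-Bessel derivative is a positive multiple of the derivative of an Abel integral
(`hasDerivWithinAt_abelInt`). For two functions with equal initial values the Caputo corrections
cancel, so at a positive maximum of their difference the difference of the derivatives is strictly
positive (`caputo_lt_of_isMax`). The functions are merely continuous in time, so the usual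
integration by parts is unavailable. Instead, Abel inversion shows that if the Abel integral of a
nonnegative `k` grows at least linearly up to `s`, then `k s > 0` (`pos_of_abelInt_growth`). Applied
to `k = g s - g`, this bounds the derivative of the Abel integral of `g` at its maximum point `s`
from below by `(s - A) ^ (-α) * g s`. For classical solutions, a positive maximum of `u₁ - u₂`
avoids the sides and the initial time. There the time terms differ strictly, while `opA_le_of_isMax`
gives the space terms the same sign, contradicting the common equation. For weak solutions, the
pairing with `ω = u₁ t₀ - u₂ t₀`, where `t₀` maximizes the norm of the difference, is itself maximal
at `t₀` by Cauchy-Schwarz. Its time derivative there equals minus the energy of `ω`, which is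
nonpositive. -/

namespace DegenerateFractional

/-! ### Abel integrals and their inversion -/

/-- The unnormalized Abel (Riemann-Liouville) integral with kernel `(s - σ) ^ (-α)`. -/
noncomputable def abelInt (α A : ℝ) (g : ℝ → ℝ) (s : ℝ) : ℝ :=
  ∫ σ in A..s, (s - σ) ^ (-α) * g σ

/-- The constant in Abel's inversion formula, the Beta integral `B(α, 1 - α)`. -/
noncomputable def abelConst (α : ℝ) : ℝ := ∫ y in (0 : ℝ)..1, (1 - y) ^ (α - 1) * y ^ (-α)

theorem intervalIntegrable_sub_rpow {r : ℝ} (hr : -1 < r) (s a b : ℝ) :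
    IntervalIntegrable (fun σ => (s - σ) ^ r) volume a b := by
  have h := (intervalIntegral.intervalIntegrable_rpow' (a := s - a) (b := s - b) hr).comp_sub_left s
  simpa using h

theorem intervalIntegrable_rpow_sub {r : ℝ} (hr : -1 < r) (τ a b : ℝ) :
    IntervalIntegrable (fun σ => (σ - τ) ^ r) volume a b := by
  have h := (intervalIntegral.intervalIntegrable_rpow'
    (a := a - τ) (b := b - τ) hr).comp_sub_right τ
  simpa using h

theorem intervalIntegrable_abel {α A S s : ℝ} (hα : α < 1) {g : ℝ → ℝ}
    (hg : ContinuousOn g (Icc A S)) {a b : ℝ} (ha : A ≤ a) (hab : a ≤ b) (hb : b ≤ S) :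
    IntervalIntegrable (fun σ => (s - σ) ^ (-α) * g σ) volume a b := by
  refine (intervalIntegrable_sub_rpow (by linarith) s a b).mul_continuousOn ?_
  rw [uIcc_of_le hab]
  exact hg.mono (Icc_subset_Icc ha hb)

/-- Each endpoint carries one singular factor; splitting at an interior point leaves the other
factor continuous. -/
theorem intervalIntegrable_beta {α τ s : ℝ} (hα : α ∈ Ioo (0 : ℝ) 1) (h : τ < s) :
    IntervalIntegrable (fun σ => (s - σ) ^ (α - 1) * (σ - τ) ^ (-α)) volume τ s := by
  obtain ⟨m, hm1, hm2⟩ := exists_between h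
  refine IntervalIntegrable.trans (b := m) ?_ ?_
  · refine (intervalIntegrable_rpow_sub (by linarith [hα.2]) τ τ m).continuousOn_mul ?_
    rw [uIcc_of_le hm1.le]
    intro σ hσ
    refine (ContinuousAt.rpow_const (by fun_prop) (Or.inl ?_)).continuousWithinAt
    have := hσ.2
    exact (by linarith : 0 < s - σ).ne'
  · refine (intervalIntegrable_sub_rpow (by linarith [hα.1]) s m s).mul_continuousOn ?_
    rw [uIcc_of_le hm2.le]
    intro σ hσ
    refine (ContinuousAt.rpow_const (by fun_prop) (Or.inl ?_)).continuousWithinAt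
    have := hσ.1
    exact (by linarith : 0 < σ - τ).ne'

/-- Rescaling to the unit interval produces powers of `s - τ` with total exponent `1 + (α - 1) - α =
0`. This independence of the endpoints is what makes Abel inversion work. -/
theorem integral_beta {α τ s : ℝ} (h : τ < s) :
    ∫ σ in τ..s, (s - σ) ^ (α - 1) * (σ - τ) ^ (-α) = abelConst α := by
  have hd : 0 < s - τ := sub_pos.2 h
  have key := intervalIntegral.smul_integral_comp_mul_add (a := 0) (b := 1)
    (fun σ => (s - σ) ^ (α - 1) * (σ - τ) ^ (-α)) (s - τ) τ
  simp only [mul_zero, zero_add, mul_one, sub_add_cancel, add_sub_cancel_right, smul_eq_mul] at key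
  rw [← key, abelConst, ← intervalIntegral.integral_const_mul]
  refine intervalIntegral.integral_congr fun y hy => ?_
  rw [uIcc_of_le zero_le_one] at hy
  have e : s - ((s - τ) * y + τ) = (s - τ) * (1 - y) := by ring
  simp only [e]
  rw [Real.mul_rpow hd.le (by linarith [hy.2]), Real.mul_rpow hd.le hy.1]
  have : (s - τ) * ((s - τ) ^ (α - 1) * (s - τ) ^ (-α)) = 1 := by
    rw [← Real.rpow_add hd, show α - 1 + -α = -1 by ring, Real.rpow_neg_one,
      mul_inv_cancel₀ hd.ne']
  linear_combination ((1 - y) ^ (α - 1) * y ^ (-α)) * this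

theorem abelConst_nonneg (α : ℝ) : 0 ≤ abelConst α :=
  intervalIntegral.integral_nonneg zero_le_one fun _ hy =>
    mul_nonneg (Real.rpow_nonneg (by linarith [hy.2]) _) (Real.rpow_nonneg hy.1 _)

/-- Abel's inversion formula. -/
theorem abel_inversion {α r s : ℝ} (hα : α ∈ Ioo (0 : ℝ) 1) (hrs : r ≤ s) {k : ℝ → ℝ}
    (hk : Continuous k) :
    IntervalIntegrable (fun σ => (s - σ) ^ (α - 1) * abelInt α r k σ) volume r s ∧
    ∫ σ in r..s, (s - σ) ^ (α - 1) * abelInt α r k σ = abelConst α * ∫ τ in r..s, k τ := by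
  set μ : Measure ℝ := volume.restrict (Ioo r s) with hμ
  -- The kernel on the triangle `τ < σ`, extended by zero to the square so that Fubini applies to a
  -- product measure.
  set F : ℝ → ℝ → ℝ := fun σ τ =>
    if τ < σ then (s - σ) ^ (α - 1) * (σ - τ) ^ (-α) * k τ else 0 with hF
  have hFm : Measurable (Function.uncurry F) := by
    refine Measurable.ite (measurableSet_lt measurable_snd measurable_fst) ?_ measurable_const
    have := hk.measurable
    fun_prop
  have hsec : ∀ τ ∈ Ioo r s, ∀ g : ℝ → ℝ,
      IntervalIntegrable g volume τ s →
      Integrable (fun σ => if τ < σ then g σ else 0) μ ∧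
        ∫ σ, (if τ < σ then g σ else 0) ∂μ = ∫ σ in τ..s, g σ := by
    intro τ hτ g hg
    have e : (fun σ => if τ < σ then g σ else 0) = (Ioi τ).indicator g := by
      ext σ; simp [indicator_apply]
    have hset : Ioi τ ∩ Ioo r s = Ioo τ s := by
      ext σ; simp only [mem_inter_iff, mem_Ioi, mem_Ioo]
      constructor
      · exact fun h => ⟨h.1, h.2.2⟩
      · exact fun h => ⟨h.1, hτ.1.trans h.1, h.2⟩
    rw [e, integrable_indicator_iff measurableSet_Ioi, integral_indicator measurableSet_Ioi, hμ,
      IntegrableOn, Measure.restrict_restrict measurableSet_Ioi, hset,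
      intervalIntegral.integral_of_le hτ.2.le, integral_Ioc_eq_integral_Ioo]
    exact ⟨(intervalIntegrable_iff_integrableOn_Ioo_of_le hτ.2.le).1 hg, rfl⟩
  have hkb : Integrable (fun τ => k τ) μ :=
    (intervalIntegrable_iff_integrableOn_Ioo_of_le hrs).1 (hk.intervalIntegrable r s)
  have hFint : Integrable (Function.uncurry F) (μ.prod μ) := by
    rw [integrable_prod_iff' hFm.aestronglyMeasurable]
    constructor
    · refine (ae_restrict_mem measurableSet_Ioo).mono fun τ hτ => ?_
      exact (hsec τ hτ _ ((intervalIntegrable_beta hα hτ.2).mul_const (k τ))).1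
    -- The inner integral of the norm is exactly `abelConst α * ‖k τ‖`, by the Beta integral.
    · refine Integrable.congr (hkb.norm.const_mul (abelConst α)) ?_
      refine (ae_restrict_mem measurableSet_Ioo).mono fun τ hτ => ?_
      have h1 := (hsec τ hτ _ ((intervalIntegrable_beta hα hτ.2).mul_const ‖k τ‖)).2
      rw [intervalIntegral.integral_mul_const, integral_beta hτ.2] at h1
      beta_reduce
      rw [← h1, hμ]
      refine setIntegral_congr_fun measurableSet_Ioo fun σ hσ => ?_
      simp only [Function.uncurry, hF]
      split_ifs with h
      · rw [norm_mul, Real.norm_of_nonneg (mul_nonneg (Real.rpow_nonneg (by linarith [hσ.2]) _)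
          (Real.rpow_nonneg (by linarith) _))]
      · simp
  have hin : ∀ σ ∈ Ioo r s, ∫ τ, F σ τ ∂μ = (s - σ) ^ (α - 1) * abelInt α r k σ := by
    intro σ hσ
    have e : (fun τ => F σ τ) =
        (Iio σ).indicator (fun τ => (s - σ) ^ (α - 1) * ((σ - τ) ^ (-α) * k τ)) := by
      ext τ; simp [indicator_apply, hF, mul_assoc]
    have hset : Iio σ ∩ Ioo r s = Ioo r σ := by
      ext τ; simp only [mem_inter_iff, mem_Iio, mem_Ioo]
      constructor
      · exact fun h => ⟨h.2.1, h.1⟩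
      · exact fun h => ⟨h.2, h.1, h.2.trans hσ.2⟩
    rw [e, integral_indicator measurableSet_Iio, hμ, Measure.restrict_restrict measurableSet_Iio,
      hset, integral_const_mul, abelInt, intervalIntegral.integral_of_le hσ.1.le,
      integral_Ioc_eq_integral_Ioo]
  have hin' : (fun σ => ∫ τ, F σ τ ∂μ) =ᵐ[μ] fun σ => (s - σ) ^ (α - 1) * abelInt α r k σ :=
    (ae_restrict_mem measurableSet_Ioo).mono hin
  constructor
  · rw [intervalIntegrable_iff_integrableOn_Ioo_of_le hrs]
    exact hFint.integral_prod_left.congr hin'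
  · rw [intervalIntegral.integral_of_le hrs, integral_Ioc_eq_integral_Ioo,
      intervalIntegral.integral_of_le hrs, integral_Ioc_eq_integral_Ioo, ← hμ,
      ← integral_congr_ae hin', integral_integral_swap hFint, ← integral_const_mul]
    refine setIntegral_congr_fun measurableSet_Ioo fun τ hτ => ?_
    have h1 := (hsec τ hτ _ ((intervalIntegrable_beta hα hτ.2).mul_const (k τ))).2
    rw [intervalIntegral.integral_mul_const, integral_beta hτ.2] at h1
    exact h1

/-! ### The extremum principle for the Riemann-Liouville derivative -/

theorem integral_sub_rpow {α r s : ℝ} (hα : 0 < α) :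
    ∫ σ in r..s, (s - σ) ^ (α - 1) = (s - r) ^ α / α := by
  rw [intervalIntegral.integral_comp_sub_left (fun x => x ^ (α - 1)) s, sub_self,
    integral_rpow (Or.inl (by linarith))]
  simp [Real.zero_rpow hα.ne']

theorem abelInt_nonneg {α A s : ℝ} {k : ℝ → ℝ} (hs : A ≤ s) (hk : ∀ σ ∈ Icc A s, 0 ≤ k σ) :
    0 ≤ abelInt α A k s :=
  intervalIntegral.integral_nonneg hs fun σ hσ =>
    mul_nonneg (Real.rpow_nonneg (by linarith [hσ.2]) _) (hk σ hσ)

/-- A nonnegative function whose Abel integral grows at least linearly does not vanish at the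
right endpoint. -/
theorem pos_of_abelInt_growth {α r s lam : ℝ} (hα : α ∈ Ioo (0 : ℝ) 1) (hrs : r < s)
    (hlam : 0 < lam) {k : ℝ → ℝ} (hk : Continuous k) (hk0 : ∀ σ ∈ Icc r s, 0 ≤ k σ)
    (hgrow : ∀ x ∈ Icc r s, ∀ y ∈ Icc r s, x ≤ y →
      lam * (y - x) ≤ abelInt α r k y - abelInt α r k x) : 0 < k s := by
  by_contra hneg
  have hks : k s = 0 := le_antisymm (not_lt.1 hneg) (hk0 s ⟨hrs.le, le_rfl⟩)
  set C := abelConst α with hC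
  have hC0 : 0 ≤ C := abelConst_nonneg α
  -- Compare the inversion formulas at `s` and `s - h`: after discarding `[r, r + h]` and
  -- translating by `h`, the growth assumption contributes an extra `lam * h` against the kernel.
  -- Dividing by `h` and letting `h → 0` would force `k s > 0`; what follows is a quantitative
  -- version.
  have hbound : ∀ h ∈ Ioo 0 (s - r),
      lam * h * ((s - h - r) ^ α / α) ≤ C * ∫ σ in (s - h)..s, k σ := by
    intro h hh
    have hrh : r ≤ s - h := by linarith [hh.2]
    obtain ⟨i1, e1⟩ := abel_inversion hα hrs.le hk
    obtain ⟨i2, e2⟩ := abel_inversion hα hrh hk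
    have i1' : IntervalIntegrable (fun σ => (s - σ) ^ (α - 1) * abelInt α r k σ) volume
        (r + h) s := i1.mono_set (by
      rw [uIcc_of_le hrs.le, uIcc_of_le (by linarith)]
      exact Icc_subset_Icc (by linarith [hh.1]) le_rfl)
    have i1'' : IntervalIntegrable (fun σ => (s - σ) ^ (α - 1) * abelInt α r k σ) volume
        r (r + h) := i1.mono_set (by
      rw [uIcc_of_le hrs.le, uIcc_of_le (by linarith [hh.1])]
      exact Icc_subset_Icc le_rfl (by linarith [hh.2]))
    have hsplit := intervalIntegral.integral_add_adjacent_intervals i1'' i1'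
    have hpos : 0 ≤ ∫ σ in r..(r + h), (s - σ) ^ (α - 1) * abelInt α r k σ := by
      refine intervalIntegral.integral_nonneg (by linarith [hh.1]) fun σ hσ => ?_
      refine mul_nonneg (Real.rpow_nonneg (by linarith [hσ.2, hh.2]) _)
        (abelInt_nonneg hσ.1 fun x hx => hk0 x ⟨hx.1, by linarith [hx.2, hσ.2, hh.2]⟩)
    have hshift : ∫ σ in r..(s - h), (s - h - σ) ^ (α - 1) * abelInt α r k (σ + h) =
        ∫ σ in (r + h)..s, (s - σ) ^ (α - 1) * abelInt α r k σ := by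
      have := intervalIntegral.integral_comp_add_right (a := r) (b := s - h)
        (fun σ => (s - σ) ^ (α - 1) * abelInt α r k σ) h
      rw [sub_add_cancel] at this
      rw [← this]
      refine intervalIntegral.integral_congr fun σ _ => ?_
      simp only [sub_add_eq_sub_sub, sub_right_comm]
    have i3 : IntervalIntegrable
        (fun σ => (s - h - σ) ^ (α - 1) * abelInt α r k (σ + h)) volume r (s - h) := by
      have := i1'.comp_add_right h
      simpa only [add_sub_cancel_right, sub_add_eq_sub_sub, sub_right_comm] using this
    have i4 : IntervalIntegrable (fun σ => (s - h - σ) ^ (α - 1) * (lam * h)) volume r (s - h) :=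
      (intervalIntegrable_sub_rpow (by linarith [hα.1]) _ _ _).mul_const _
    have hmono : ∫ σ in r..(s - h), ((s - h - σ) ^ (α - 1) * abelInt α r k σ +
          (s - h - σ) ^ (α - 1) * (lam * h)) ≤
        ∫ σ in r..(s - h), (s - h - σ) ^ (α - 1) * abelInt α r k (σ + h) := by
      refine intervalIntegral.integral_mono_on hrh (i2.add i4) i3 fun σ hσ => ?_
      rw [← mul_add]
      refine mul_le_mul_of_nonneg_left ?_ (Real.rpow_nonneg (by linarith [hσ.2]) _)
      have := hgrow σ ⟨hσ.1, by linarith [hσ.2, hh.1]⟩ (σ + h)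
        ⟨by linarith [hσ.1, hh.1], by linarith [hσ.2]⟩ (by linarith [hh.1])
      rw [add_sub_cancel_left] at this
      linarith
    rw [intervalIntegral.integral_add i2 i4, intervalIntegral.integral_mul_const,
      integral_sub_rpow hα.1, hshift] at hmono
    have hkk := intervalIntegral.integral_add_adjacent_intervals (hk.intervalIntegrable r (s - h))
      (hk.intervalIntegrable (μ := volume) (s - h) s)
    rw [← hkk, mul_add, ← hC] at e1
    rw [← hC] at e2
    linarith
  set δ := s - r with hδ
  have hδ0 : 0 < δ := sub_pos.2 hrs
  set c := lam * ((δ / 2) ^ α / α) with hc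
  have hc0 : 0 < c := mul_pos hlam (div_pos (Real.rpow_pos_of_pos (by linarith) _) hα.1)
  -- With this threshold the right side of `hbound` is less than `h * c`; the `+ 1` avoids having to
  -- prove `C` positive.
  obtain ⟨η, hη0, hη⟩ := Metric.continuousAt_iff.1 (hk.continuousAt (x := s)) (c / (2 * (C + 1)))
    (by positivity)
  set h := min (δ / 2) (η / 2) with hh
  have hh0 : 0 < h := lt_min (by linarith) (by linarith)
  have hh1 : h ≤ δ / 2 := min_le_left _ _
  have hh2 : h ≤ η / 2 := min_le_right _ _
  have b1 := hbound h ⟨hh0, by linarith⟩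
  have b2 : ∫ σ in (s - h)..s, k σ ≤ ∫ _ in (s - h)..s, c / (2 * (C + 1)) := by
    refine intervalIntegral.integral_mono_on (by linarith) (hk.intervalIntegrable _ _)
      intervalIntegrable_const fun σ hσ => ?_
    have := hη (x := σ) (by
      rw [Real.dist_eq, abs_lt]; constructor <;> linarith [hσ.1, hσ.2])
    rw [Real.dist_eq, hks, sub_zero] at this
    exact (le_abs_self _).trans this.le
  rw [intervalIntegral.integral_const, sub_sub_cancel, smul_eq_mul] at b2
  have b3 : h * c ≤ lam * h * ((s - h - r) ^ α / α) := by
    have : (δ / 2) ^ α ≤ (s - h - r) ^ α :=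
      Real.rpow_le_rpow (by linarith) (by linarith) hα.1.le
    have h2 : (δ / 2) ^ α / α ≤ (s - h - r) ^ α / α := div_le_div_of_nonneg_right this hα.1.le
    have := mul_le_mul_of_nonneg_left h2 (mul_pos hlam hh0).le
    rw [hc]; linarith
  have b4 : C * ∫ σ in (s - h)..s, k σ ≤ C * (h * (c / (2 * (C + 1)))) :=
    mul_le_mul_of_nonneg_left b2 hC0
  have b5 : C * (h * (c / (2 * (C + 1)))) = h * c * (C / (2 * (C + 1))) := by ring
  have b6 : C / (2 * (C + 1)) < 1 := by rw [div_lt_one (by positivity)]; linarith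
  have := mul_lt_mul_of_pos_left b6 (mul_pos hh0 hc0)
  linarith

/-- At a zero of a nonnegative function the Riemann-Liouville derivative is nonpositive. -/
theorem abelInt_deriv_nonpos {α A s : ℝ} (hα : α ∈ Ioo (0 : ℝ) 1) (hAs : A < s) {k q : ℝ → ℝ}
    (hk : Continuous k) (hk0 : ∀ σ ∈ Icc A s, 0 ≤ k σ) (hks : k s = 0)
    (hd : ∀ x ∈ Ioc A s, HasDerivWithinAt (abelInt α A k) (q x) (Ioc A s) x)
    (hq : ContinuousWithinAt q (Ioc A s) s) : q s ≤ 0 := by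
  by_contra! hpos
  set lam := q s / 2 with hlam
  have hev : ∀ᶠ x in 𝓝[Ioc A s] s, lam < q x :=
    hq.eventually (lt_mem_nhds (by linarith : lam < q s))
  obtain ⟨r, hrs, hAr, hr⟩ : ∃ r, r < s ∧ A < r ∧ ∀ x ∈ Icc r s, lam < q x := by
    obtain ⟨ε, hε, hb⟩ := Metric.mem_nhdsWithin_iff.1 hev
    refine ⟨max (s - ε / 2) ((A + s) / 2), max_lt (by linarith) (by linarith),
      lt_max_of_lt_right (by linarith), fun x hx => hb ⟨?_, ?_, hx.2⟩⟩
    · have := (le_max_left _ _).trans hx.1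
      rw [Metric.mem_ball, Real.dist_eq, abs_lt]; constructor <;> linarith [hx.2]
    · have := (le_max_right _ _).trans hx.1
      linarith
  have hsub : Icc r s ⊆ Ioc A s := fun x hx => ⟨hAr.trans_le hx.1, hx.2⟩
  have hmono : MonotoneOn (fun x => abelInt α A k x - lam * x) (Icc r s) := by
    have hder : ∀ x ∈ Icc r s, HasDerivWithinAt (fun x => abelInt α A k x - lam * x) (q x - lam)
        (Icc r s) x := fun x hx =>
      ((hd x (hsub hx)).mono hsub).sub (by simpa using (hasDerivWithinAt_id x _).const_mul lam)
    refine monotoneOn_of_hasDerivWithinAt_nonneg (convex_Icc r s)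
      (fun x hx => (hder x hx).continuousWithinAt)
      (fun x hx => (hder x (interior_subset hx)).mono interior_subset)
      (fun x hx => by linarith [hr x (interior_subset hx)])
  have hsplit : ∀ x ∈ Icc r s, abelInt α A k x =
      (∫ σ in A..r, (x - σ) ^ (-α) * k σ) + abelInt α r k x := fun x hx =>
    (intervalIntegral.integral_add_adjacent_intervals
      (intervalIntegrable_abel hα.2 hk.continuousOn le_rfl hAr.le hrs.le)
      (intervalIntegrable_abel hα.2 hk.continuousOn hAr.le hx.1 hx.2)).symm
  refine (pos_of_abelInt_growth hα hrs (by linarith : 0 < lam) hk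
    (fun σ hσ => hk0 σ ⟨hAr.le.trans hσ.1, hσ.2⟩) fun x hx y hy hxy => ?_).ne' hks
  have h1 := hmono hx hy hxy
  simp only at h1
  -- The history before `r` can only decrease, because the kernel decreases in time and `k ≥ 0`; all
  -- the growth therefore comes from the integral started at `r`.
  have h2 : ∫ σ in A..r, (y - σ) ^ (-α) * k σ ≤ ∫ σ in A..r, (x - σ) ^ (-α) * k σ := by
    refine intervalIntegral.integral_mono_on_of_le_Ioo hAr.le
      (intervalIntegrable_abel hα.2 hk.continuousOn le_rfl hAr.le hrs.le)
      (intervalIntegrable_abel hα.2 hk.continuousOn le_rfl hAr.le hrs.le) fun σ hσ => ?_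
    refine mul_le_mul_of_nonneg_right ?_ (hk0 σ ⟨hσ.1.le, hσ.2.le.trans hrs.le⟩)
    exact Real.rpow_le_rpow_of_nonpos (by linarith [hσ.2, hx.1]) (by linarith)
      (by linarith [hα.1])
  rw [hsplit x hx, hsplit y hy] at h1
  linarith

theorem abelInt_const {α A s c : ℝ} (hα : α < 1) :
    abelInt α A (fun _ => c) s = (s - A) ^ (1 - α) / (1 - α) * c := by
  have := integral_sub_rpow (α := 1 - α) (r := A) (s := s) (by linarith)
  rw [sub_sub_cancel_left] at this
  rw [abelInt, intervalIntegral.integral_mul_const, this]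

theorem abelInt_congr {α A s : ℝ} {g g' : ℝ → ℝ} (hs : A ≤ s) (h : EqOn g g' (Icc A s)) :
    abelInt α A g s = abelInt α A g' s :=
  intervalIntegral.integral_congr fun σ hσ => by
    rw [uIcc_of_le hs] at hσ; simp only [h hσ]

theorem abelInt_sub {α A S s : ℝ} (hα : α < 1) {g g' : ℝ → ℝ} (hg : ContinuousOn g (Icc A S))
    (hg' : ContinuousOn g' (Icc A S)) (hs : s ∈ Icc A S) :
    abelInt α A (fun σ => g σ - g' σ) s = abelInt α A g s - abelInt α A g' s := by
  rw [abelInt, abelInt, abelInt, ← intervalIntegral.integral_sub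
    (intervalIntegrable_abel hα hg le_rfl hs.1 hs.2)
    (intervalIntegrable_abel hα hg' le_rfl hs.1 hs.2)]
  simp only [mul_sub]

/-- The extremum principle: at a positive maximum the Riemann-Liouville derivative of a continuous
function is positive. -/
theorem abelInt_deriv_pos_of_isMax {α A S s : ℝ} (hα : α ∈ Ioo (0 : ℝ) 1) (hs : s ∈ Ioc A S)
    {g q : ℝ → ℝ} (hg : ContinuousOn g (Icc A S))
    (hd : ∀ x ∈ Ioc A S, HasDerivWithinAt (abelInt α A g) (q x) (Ioc A S) x)
    (hq : ContinuousOn q (Ioc A S)) (hmax : ∀ x ∈ Icc A S, g x ≤ g s) (hpos : 0 < g s) :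
    0 < q s := by
  -- Projecting onto `[A, s]` makes `k` continuous on the whole line, as the inversion formula
  -- requires, without changing its Abel integrals up to `s`.
  set k : ℝ → ℝ := fun x => g s - g (projIcc A s hs.1.le x) with hk
  have hsubc : Icc A s ⊆ Icc A S := Icc_subset_Icc le_rfl hs.2
  have hsub : Ioc A s ⊆ Ioc A S := Ioc_subset_Ioc le_rfl hs.2
  have hkc : Continuous k := by
    have h : Continuous ((Icc A s).domRestrict g) := (hg.mono hsubc).domRestrict
    exact continuous_const.sub (h.comp continuous_projIcc)
  have hke : EqOn k (fun x => g s - g x) (Icc A s) := fun x hx => by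
    simp only [hk, projIcc_of_mem hs.1.le hx]
  have hke' : EqOn (abelInt α A k)
      (fun x => (x - A) ^ (1 - α) / (1 - α) * g s - abelInt α A g x) (Ioc A s) := fun x hx => by
    rw [abelInt_congr hx.1.le (hke.mono (Icc_subset_Icc le_rfl hx.2)),
      abelInt_sub (S := S) hα.2 continuousOn_const hg ⟨hx.1.le, hx.2.trans hs.2⟩,
      abelInt_const hα.2]
  have h1α : (1 - α) ≠ 0 := by linarith [hα.2]
  have := abelInt_deriv_nonpos (q := fun x => (x - A) ^ (-α) * g s - q x) hα hs.1 hkc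
    (fun σ hσ => by rw [hke hσ]; exact sub_nonneg.2 (hmax σ (hsubc hσ)))
    (by rw [hke ⟨hs.1.le, le_rfl⟩]; simp)
    (fun x hx => by
      refine HasDerivWithinAt.congr (HasDerivWithinAt.sub ?_ ((hd x (hsub hx)).mono hsub)) hke'
        (hke' hx)
      have h0 : x - A ≠ 0 := by linarith [hx.1]
      have := (((hasDerivAt_id x).sub_const A).rpow_const (p := 1 - α) (Or.inl h0)).div_const
        (1 - α) |>.mul_const (g s)
      refine this.hasDerivWithinAt.congr_deriv ?_
      rw [id, one_mul, sub_sub_cancel_left, mul_div_cancel_left₀ _ h1α])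
    (by
      refine ContinuousWithinAt.sub (ContinuousAt.continuousWithinAt ?_) ((hq s hs).mono hsub)
      have h0 : s - A ≠ 0 := by linarith [hs.1]
      exact ((continuousAt_id.sub continuousAt_const).rpow_const (Or.inl h0)).mul
        continuousAt_const)
  have hp : 0 < (s - A) ^ (-α) * g s :=
    mul_pos (Real.rpow_pos_of_pos (by linarith [hs.1]) _) hpos
  linarith

/-! ### The change of variable `s = t ^ p` -/

/-- Open intervals keep the substitution away from the origin, where `x ^ p` need not be
differentiable if `a = 0`. -/
theorem image_rpow_Ioo {p a t : ℝ} (hp : 0 < p) (ha : 0 ≤ a) (ht : 0 ≤ t) :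
    (fun x : ℝ => x ^ p) '' Ioo a t = Ioo (a ^ p) (t ^ p) := by
  ext y
  constructor
  · rintro ⟨x, hx, rfl⟩
    exact ⟨Real.rpow_lt_rpow ha hx.1 hp, Real.rpow_lt_rpow (ha.trans hx.1.le) hx.2 hp⟩
  · intro hy
    have hy0 : 0 ≤ y := (Real.rpow_nonneg ha p).trans hy.1.le
    refine ⟨y ^ p⁻¹, ⟨?_, ?_⟩, Real.rpow_inv_rpow hy0 hp.ne'⟩
    · exact (Real.lt_rpow_inv_iff_of_pos ha hy0 hp).2 hy.1
    · exact (Real.rpow_inv_lt_iff_of_pos hy0 ht hp).2 hy.2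

theorem rpow_inv_mem_Ioc {p a T s : ℝ} (hp : 0 < p) (ha : 0 ≤ a) (hT : 0 ≤ T)
    (hs : s ∈ Ioc (a ^ p) (T ^ p)) : s ^ p⁻¹ ∈ Ioc a T := by
  have hs0 : 0 ≤ s := (Real.rpow_nonneg ha p).trans hs.1.le
  exact ⟨(Real.lt_rpow_inv_iff_of_pos ha hs0 hp).2 hs.1,
    (Real.rpow_inv_le_iff_of_pos hs0 hT hp).2 hs.2⟩

theorem rpow_inv_mem_Icc {p a T s : ℝ} (hp : 0 < p) (ha : 0 ≤ a) (hT : 0 ≤ T)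
    (hs : s ∈ Icc (a ^ p) (T ^ p)) : s ^ p⁻¹ ∈ Icc a T := by
  have hs0 : 0 ≤ s := (Real.rpow_nonneg ha p).trans hs.1
  exact ⟨(Real.le_rpow_inv_iff_of_pos ha hs0 hp).2 hs.1,
    (Real.rpow_inv_le_iff_of_pos hs0 hT hp).2 hs.2⟩

/-- In the variable `s = t ^ p` the Erdelyi-Kober integral is an Abel integral. -/
theorem ekIntegral_eq_abelInt {p α a t : ℝ} (hp : 0 < p) (ha : 0 ≤ a) (ht : a < t) (g : ℝ → ℝ) :
    ekIntegral p (-α + α) (1 - α) a g t = t ^ (-p * (1 - α)) / Real.Gamma (1 - α) *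
      abelInt α (a ^ p) (fun σ => g (σ ^ p⁻¹)) (t ^ p) := by
  have hle : a ^ p ≤ t ^ p := Real.rpow_le_rpow ha ht.le hp.le
  rw [ekIntegral, abelInt, neg_add_cancel, zero_add, intervalIntegral.integral_of_le ht.le,
    intervalIntegral.integral_of_le hle, integral_Ioc_eq_integral_Ioo,
    integral_Ioc_eq_integral_Ioo, ← image_rpow_Ioo hp ha (ha.trans ht.le),
    integral_image_eq_integral_abs_deriv_smul (f' := fun x => p * x ^ (p - 1)) measurableSet_Ioo]
  · congr 1
    refine setIntegral_congr_fun measurableSet_Ioo fun x hx => ?_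
    have hx0 : 0 < x := ha.trans_lt hx.1
    have hd : 0 < p * x ^ (p - 1) := mul_pos hp (Real.rpow_pos_of_pos hx0 _)
    simp only [smul_eq_mul]
    rw [abs_of_pos hd, Real.rpow_rpow_inv hx0.le hp.ne', mul_zero, Real.rpow_zero,
      sub_sub_cancel_left]
    ring
  · intro x hx
    exact (Real.hasDerivAt_rpow_const (Or.inl (ha.trans_lt hx.1).ne')).hasDerivWithinAt
  · intro x hx y hy h
    exact Real.rpow_left_injOn hp.ne' (ha.trans hx.1.le) (ha.trans hy.1.le) h

/-- In the variable `s = t ^ (1 - θ)` the hyper-Bessel derivative is a multiple of the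
Riemann-Liouville derivative. -/
theorem hasDerivWithinAt_abelInt {α θ a T : ℝ} (hα : α ∈ Ioo (0 : ℝ) 1) (hθ : θ < 1) (ha : 0 ≤ a)
    (haT : a < T) {g : ℝ → ℝ} (hg : HasHyperBessel α θ a T g) {s : ℝ}
    (hs : s ∈ Ioc (a ^ (1 - θ)) (T ^ (1 - θ))) :
    HasDerivWithinAt (abelInt α (a ^ (1 - θ)) (fun σ => g (σ ^ (1 - θ)⁻¹)))
      (Real.Gamma (1 - α) * (1 - θ) ^ (-α) * hyperBessel α θ a T g (s ^ (1 - θ)⁻¹))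
      (Ioc (a ^ (1 - θ)) (T ^ (1 - θ))) s := by
  rw [HasHyperBessel] at hg
  rw [hyperBessel, ekDeriv]
  set p := 1 - θ with hp'
  have hp : 0 < p := sub_pos.2 hθ
  have hT : 0 ≤ T := ha.trans haT.le
  set E := ekIntegral p (-α + α) (1 - α) a g with hE
  have hΓ : 0 < Real.Gamma (1 - α) := Real.Gamma_pos_of_pos (by linarith [hα.2])
  have hpos : ∀ x ∈ Ioc (a ^ p) (T ^ p), 0 < x := fun x hx =>
    (Real.rpow_nonneg ha p).trans_lt hx.1
  have heq : EqOn (abelInt α (a ^ p) (fun σ => g (σ ^ p⁻¹)))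
      (fun x => Real.Gamma (1 - α) * (x ^ (1 - α) * E (x ^ p⁻¹))) (Ioc (a ^ p) (T ^ p)) := by
    intro x hx
    have hx0 := hpos x hx
    have hxm := rpow_inv_mem_Ioc hp ha hT hx
    simp only [hE]
    rw [ekIntegral_eq_abelInt hp ha hxm.1, Real.rpow_inv_rpow hx0.le hp.ne', ← Real.rpow_mul hx0.le,
      show p⁻¹ * (-p * (1 - α)) = -(1 - α) by field_simp, Real.rpow_neg hx0.le]
    have := (Real.rpow_pos_of_pos hx0 (1 - α)).ne'
    field_simp
  have hs0 := hpos s hs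
  have hsm := rpow_inv_mem_Ioc hp ha hT hs
  have hE' := (hg _ hsm).hasDerivWithinAt
  have hcomp := HasDerivWithinAt.comp s hE'
    (Real.hasDerivAt_rpow_const (p := p⁻¹) (Or.inl hs0.ne')).hasDerivWithinAt
    (fun x hx => rpow_inv_mem_Ioc hp ha hT hx)
  have hmul := (((Real.hasDerivAt_rpow_const (p := 1 - α) (Or.inl hs0.ne')).hasDerivWithinAt
    (s := Ioc (a ^ p) (T ^ p))).mul hcomp).const_mul (Real.Gamma (1 - α))
  refine (hmul.congr heq (heq hs)).congr_deriv ?_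
  have e1 : (s ^ p⁻¹) ^ (-p * α) = s ^ (-α) := by
    rw [← Real.rpow_mul hs0.le]; congr 1; field_simp
  have e2 : s ^ (1 - α) * s ^ (p⁻¹ - 1) = s ^ (-α) * s ^ p⁻¹ := by
    rw [← Real.rpow_add hs0, ← Real.rpow_add hs0]; congr 1; ring
  have e3 : p ^ (-α) * p ^ α = 1 := by
    rw [← Real.rpow_add hp, neg_add_cancel, Real.rpow_zero]
  rw [e1, sub_sub_cancel_left]
  simp only [Function.comp]
  set D := derivWithin E (Ioc a T) (s ^ p⁻¹)
  linear_combination (Real.Gamma (1 - α) * D * p⁻¹) * e2 -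
    (Real.Gamma (1 - α) * s ^ (-α) * ((-α + 1) * E (s ^ p⁻¹) + s ^ p⁻¹ / p * D)) * e3

/-- Two functions with the same initial value: where their difference has a positive maximum, so has
the difference of their Caputo-like derivatives. -/
theorem caputo_lt_of_isMax {α θ a T : ℝ} (hα : α ∈ Ioo (0 : ℝ) 1) (hθ : θ < 1) (ha : 0 ≤ a)
    (haT : a < T) {g₁ g₂ : ℝ → ℝ} (h₁ : HasHyperBessel α θ a T g₁)
    (h₂ : HasHyperBessel α θ a T g₂) (hc₁ : ContinuousOn g₁ (Icc a T))
    (hc₂ : ContinuousOn g₂ (Icc a T)) (h0 : g₁ a = g₂ a)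
    (hD : ContinuousOn
      (fun t => caputoHyperBessel α θ a T g₁ t - caputoHyperBessel α θ a T g₂ t) (Ioc a T))
    {t₀ : ℝ} (ht₀ : t₀ ∈ Ioc a T) (hmax : ∀ t ∈ Icc a T, g₁ t - g₂ t ≤ g₁ t₀ - g₂ t₀)
    (hpos : g₂ t₀ < g₁ t₀) :
    caputoHyperBessel α θ a T g₂ t₀ < caputoHyperBessel α θ a T g₁ t₀ := by
  have hp : 0 < 1 - θ := sub_pos.2 hθ
  have hT : 0 ≤ T := ha.trans haT.le
  have ht0 : 0 ≤ t₀ := ha.trans ht₀.1.le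
  -- Equal initial values cancel the Caputo corrections.
  have hcD : ∀ t, caputoHyperBessel α θ a T g₁ t - caputoHyperBessel α θ a T g₂ t =
      hyperBessel α θ a T g₁ t - hyperBessel α θ a T g₂ t := fun t => by
    simp only [caputoHyperBessel, h0]; ring
  simp only [hcD] at hD
  set p := 1 - θ with hp'
  have hs₀ : t₀ ^ p ∈ Ioc (a ^ p) (T ^ p) :=
    ⟨Real.rpow_lt_rpow ha ht₀.1 hp, Real.rpow_le_rpow ht0 ht₀.2 hp.le⟩
  have hinv : (t₀ ^ p) ^ p⁻¹ = t₀ := Real.rpow_rpow_inv ht0 hp.ne'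
  have hcr : ∀ X : Set ℝ, ContinuousOn (fun σ : ℝ => σ ^ p⁻¹) X := fun X =>
    (Real.continuous_rpow_const (inv_nonneg.2 hp.le)).continuousOn
  have hmaps : MapsTo (fun σ : ℝ => σ ^ p⁻¹) (Icc (a ^ p) (T ^ p)) (Icc a T) := fun x hx =>
    rpow_inv_mem_Icc hp ha hT hx
  have hg₁ : ContinuousOn (fun σ => g₁ (σ ^ p⁻¹)) (Icc (a ^ p) (T ^ p)) :=
    hc₁.comp (hcr _) hmaps
  have hg₂ : ContinuousOn (fun σ => g₂ (σ ^ p⁻¹)) (Icc (a ^ p) (T ^ p)) :=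
    hc₂.comp (hcr _) hmaps
  have hsub : EqOn (abelInt α (a ^ p) fun σ => g₁ (σ ^ p⁻¹) - g₂ (σ ^ p⁻¹))
      (fun x => abelInt α (a ^ p) (fun σ => g₁ (σ ^ p⁻¹)) x -
        abelInt α (a ^ p) (fun σ => g₂ (σ ^ p⁻¹)) x) (Ioc (a ^ p) (T ^ p)) := fun x hx =>
    abelInt_sub hα.2 hg₁ hg₂ (Ioc_subset_Icc_self hx)
  have key := abelInt_deriv_pos_of_isMax hα hs₀ (hg₁.sub hg₂)
    (q := fun s => Real.Gamma (1 - α) * p ^ (-α) *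
      (hyperBessel α θ a T g₁ (s ^ p⁻¹) - hyperBessel α θ a T g₂ (s ^ p⁻¹)))
    (fun x hx => by
      rw [mul_sub]
      exact ((hasDerivWithinAt_abelInt hα hθ ha haT h₁ hx).sub
        (hasDerivWithinAt_abelInt hα hθ ha haT h₂ hx)).congr hsub (hsub hx))
    (continuousOn_const.mul
      (hD.comp (hcr _) fun x hx => rpow_inv_mem_Ioc hp ha hT hx))
    (fun x hx => by
      simp only [Pi.sub_apply, hinv]
      exact hmax _ (hmaps hx))
    (by simp only [Pi.sub_apply, hinv]; linarith)
  simp only [hinv] at key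
  have hc : 0 < Real.Gamma (1 - α) * p ^ (-α) :=
    mul_pos (Real.Gamma_pos_of_pos (by linarith [hα.2])) (Real.rpow_pos_of_pos hp _)
  have := (mul_pos_iff_of_pos_left hc).1 key
  rw [← hcD] at this
  linarith

/-! ### Initial values and the comparison principle for classical solutions -/

theorem eq_of_tendsto_right {X : Type*} [TopologicalSpace X] [T2Space X] {a T : ℝ} (haT : a < T)
    {u : ℝ → X} {φ : X} (hu : ContinuousOn u (Icc a T)) (h : Tendsto u (𝓝[>] a) (𝓝 φ)) :
    u a = φ := by
  refine tendsto_nhds_unique (Tendsto.mono_left (hu a ⟨le_rfl, haT.le⟩) ?_) h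
  rw [← nhdsWithin_Ioo_eq_nhdsGT haT]
  exact nhdsWithin_mono _ Ioo_subset_Icc_self

/-- At an interior maximum of `v₁ - v₂` the degenerate operator satisfies `A v₂ ≤ A v₁`. -/
theorem opA_le_of_isMax {β : ℝ} {v₁ v₂ : ℝ → ℝ} {x₀ : ℝ} (hx₀ : x₀ ∈ Ioo (0 : ℝ) 1)
    (h₁ : ∀ x ∈ Ioo (0 : ℝ) 1, DifferentiableAt ℝ v₁ x ∧
      DifferentiableAt ℝ (fun y => y ^ β * deriv v₁ y) x)
    (h₂ : ∀ x ∈ Ioo (0 : ℝ) 1, DifferentiableAt ℝ v₂ x ∧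
      DifferentiableAt ℝ (fun y => y ^ β * deriv v₂ y) x)
    (hmax : ∀ x ∈ Ioo (0 : ℝ) 1, v₁ x - v₂ x ≤ v₁ x₀ - v₂ x₀) :
    opA β v₂ x₀ ≤ opA β v₁ x₀ := by
  by_contra! hlt
  have hv : ∀ x ∈ Ioo (0 : ℝ) 1,
      HasDerivAt (fun y => v₁ y - v₂ y) (deriv v₁ x - deriv v₂ x) x := fun x hx =>
    (h₁ x hx).1.hasDerivAt.sub (h₂ x hx).1.hasDerivAt
  have hzero : deriv v₁ x₀ - deriv v₂ x₀ = 0 := by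
    refine IsLocalMax.hasDerivAt_eq_zero ?_ (hv x₀ hx₀)
    filter_upwards [Ioo_mem_nhds hx₀.1 hx₀.2] with x hx using hmax x hx
  have hw := (h₁ x₀ hx₀).2.hasDerivAt.sub (h₂ x₀ hx₀).2.hasDerivAt
  set D := deriv (fun y => y ^ β * deriv v₁ y) x₀ - deriv (fun y => y ^ β * deriv v₂ y) x₀ with hD
  have hDpos : 0 < D := by
    simp only [opA] at hlt
    linarith
  -- The flux difference `x ^ β (v₁' - v₂')` vanishes at `x₀` with positive slope, so `v₁ - v₂`
  -- increases strictly just to the right of its maximum point. No second derivative of `v₁` or `v₂`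
  -- is needed.
  have hslope := (hasDerivAt_iff_tendsto_slope.1 hw).eventually (lt_mem_nhds hDpos)
  have hright : ∀ᶠ x in 𝓝[>] x₀, x < 1 ∧ 0 < deriv v₁ x - deriv v₂ x := by
    have hne : 𝓝[>] x₀ ≤ 𝓝[≠] x₀ := nhdsWithin_mono _ fun x hx => ne_of_gt hx
    filter_upwards [hne hslope, Ioo_mem_nhdsGT hx₀.2] with x hx hx1
    refine ⟨hx1.2, ?_⟩
    have hs : x₀ ^ β * deriv v₁ x₀ - x₀ ^ β * deriv v₂ x₀ = 0 := by
      rw [← mul_sub, hzero, mul_zero]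
    simp only [slope_def_field, Pi.sub_apply, hs, sub_zero] at hx
    rw [← mul_sub, div_pos_iff_of_pos_right (sub_pos.2 hx1.1)] at hx
    exact (mul_pos_iff_of_pos_left (Real.rpow_pos_of_pos (hx₀.1.trans hx1.1) _)).1 hx
  obtain ⟨x₁, hx₁, hx₁'⟩ := (mem_nhdsGT_iff_exists_Ioc_subset).1 hright
  have hsub : Icc x₀ x₁ ⊆ Ioo (0 : ℝ) 1 := fun x hx =>
    ⟨hx₀.1.trans_le hx.1, hx.2.trans_lt (hx₁' ⟨hx₁, le_rfl⟩).1⟩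
  have hmono : StrictMonoOn (fun y => v₁ y - v₂ y) (Icc x₀ x₁) := by
    refine strictMonoOn_of_deriv_pos (convex_Icc _ _)
      (fun x hx => (hv x (hsub hx)).continuousAt.continuousWithinAt) fun x hx => ?_
    rw [interior_Icc] at hx
    rw [(hv x (hsub (Ioo_subset_Icc_self hx))).deriv]
    exact (hx₁' ⟨hx.1, hx.2.le⟩).2
  have hx₁0 : x₀ < x₁ := hx₁
  have h3 := hmono ⟨le_rfl, hx₁0.le⟩ ⟨hx₁0.le, le_rfl⟩ hx₁0
  have h4 := hmax x₁ (hsub ⟨hx₁0.le, le_rfl⟩)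
  simp only at h3
  linarith

/-- The comparison principle for classical solutions with the same data. -/
theorem IsClassicalSolution.le {α θ β a T : ℝ} (hα : α ∈ Ioo (0 : ℝ) 1) (hθ : θ < 1)
    (ha : 0 ≤ a) (haT : a < T) (hβ : β < 1) {f : ℝ → ℝ → ℝ} {φ : ℝ → ℝ} {u₁ u₂ : ℝ → ℝ → ℝ}
    (h₁ : IsClassicalSolution α θ β a T f φ u₁) (h₂ : IsClassicalSolution α θ β a T f φ u₂)
    {x t : ℝ} (hx : x ∈ Icc (0 : ℝ) 1) (ht : t ∈ Icc a T) : u₁ x t ≤ u₂ x t := by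
  obtain ⟨⟨x₀, t₀⟩, ⟨hx₀, ht₀⟩, hmax⟩ := (isCompact_Icc.prod isCompact_Icc).exists_isMaxOn
    ⟨(x, t), hx, ht⟩ (h₁.continuousOn.sub h₂.continuousOn)
  have hmax' : ∀ y ∈ Icc (0 : ℝ) 1, ∀ s ∈ Icc a T,
      u₁ y s - u₂ y s ≤ u₁ x₀ t₀ - u₂ x₀ t₀ := fun y hy s hs =>
    hmax (show (y, s) ∈ Icc (0 : ℝ) 1 ×ˢ Icc a T from ⟨hy, hs⟩)
  simp only at hx₀ ht₀
  have hslice : ∀ {u}, IsClassicalSolution α θ β a T f φ u → ∀ y ∈ Icc (0 : ℝ) 1,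
      ContinuousOn (u y) (Icc a T) := fun hu y hy =>
    hu.continuousOn.comp (f := fun s : ℝ => (y, s)) (by fun_prop) fun s hs => ⟨hy, hs⟩
  have hinit : ∀ y ∈ Icc (0 : ℝ) 1, u₁ y a = u₂ y a := fun y hy =>
    (eq_of_tendsto_right haT (hslice h₁ y hy) (h₁.initial y hy)).trans
      (eq_of_tendsto_right haT (hslice h₂ y hy) (h₂.initial y hy)).symm
  by_contra! hlt
  have hpos : 0 < u₁ x₀ t₀ - u₂ x₀ t₀ := (sub_pos.2 hlt).trans_le (hmax' x hx t ht)
  have hx0 : x₀ ≠ 0 := by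
    rintro rfl
    rw [h₁.boundary_left hβ t₀ ht₀, h₂.boundary_left hβ t₀ ht₀] at hpos
    simp at hpos
  have hx1 : x₀ ≠ 1 := by
    rintro rfl
    rw [h₁.boundary_right t₀ ht₀, h₂.boundary_right t₀ ht₀] at hpos
    simp at hpos
  have hta : t₀ ≠ a := by
    rintro rfl
    rw [hinit x₀ hx₀] at hpos
    simp at hpos
  have hx₀' : x₀ ∈ Ioo (0 : ℝ) 1 :=
    ⟨lt_of_le_of_ne hx₀.1 hx0.symm, lt_of_le_of_ne hx₀.2 hx1⟩
  have ht₀' : t₀ ∈ Ioc a T := ⟨lt_of_le_of_ne ht₀.1 hta.symm, ht₀.2⟩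
  have htime := caputo_lt_of_isMax hα hθ ha haT (h₁.time_exists x₀ hx₀') (h₂.time_exists x₀ hx₀')
    (hslice h₁ x₀ hx₀) (hslice h₂ x₀ hx₀) (hinit x₀ hx₀)
    ((h₁.time_continuousOn.comp (f := fun s : ℝ => (x₀, s)) (by fun_prop)
      fun s hs => ⟨hx₀', hs⟩).sub
      (h₂.time_continuousOn.comp (f := fun s : ℝ => (x₀, s)) (by fun_prop)
        fun s hs => ⟨hx₀', hs⟩))
    ht₀' (fun s hs => hmax' x₀ hx₀ s hs) (by linarith)
  have hspace := opA_le_of_isMax hx₀' (h₁.space_exists t₀ ht₀') (h₂.space_exists t₀ ht₀')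
    fun y hy => hmax' y (Ioo_subset_Icc_self hy) t₀ ht₀
  have e₁ := h₁.equation x₀ hx₀' t₀ ht₀'
  have e₂ := h₂.equation x₀ hx₀' t₀ ht₀'
  linarith

/-! ### Energy argument for weak solutions -/

theorem MemDomainA.sub {β : ℝ} {v w : ℝ → ℝ} (hv : MemDomainA β v) (hw : MemDomainA β w) :
    MemDomainA β (fun x => v x - w x) where
  continuousOn := hv.continuousOn.sub hw.continuousOn
  differentiableAt x hx := (hv.differentiableAt x hx).sub (hw.differentiableAt x hx)
  flux := by
    obtain ⟨w₁, z₁, hc₁, he₁, hd₁, hz₁⟩ := hv.flux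
    obtain ⟨w₂, z₂, hc₂, he₂, hd₂, hz₂⟩ := hw.flux
    refine ⟨fun x => w₁ x - w₂ x, fun x => z₁ x - z₂ x, hc₁.sub hc₂, fun x hx => ?_,
      fun x hx => (hd₁ x hx).sub (hd₂ x hx), hz₁.sub hz₂⟩
    beta_reduce
    rw [deriv_fun_sub (hv.differentiableAt x hx) (hw.differentiableAt x hx),
      he₁ x hx, he₂ x hx, mul_sub]
  boundary_left hβ := by rw [hv.boundary_left hβ, hw.boundary_left hβ, sub_zero]
  boundary_right := by rw [hv.boundary_right, hw.boundary_right, sub_zero]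

theorem sub_mem_domainGraph {β : ℝ} {p q : L2 × L2} (hp : p ∈ domainGraph β)
    (hq : q ∈ domainGraph β) : p - q ∈ domainGraph β := by
  obtain ⟨v, hv, hv1, hv2⟩ := hp
  obtain ⟨w, hw, hw1, hw2⟩ := hq
  refine ⟨_, hv.sub hw, ?_, ?_⟩
  · filter_upwards [Lp.coeFn_sub p.1 q.1, hv1, hw1] with x hx h1 h2
    rw [Prod.fst_sub, hx, Pi.sub_apply, h1, h2]
  · filter_upwards [Lp.coeFn_sub p.2 q.2, hv2, hw2, ae_restrict_mem measurableSet_Ioo]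
      with x hx h1 h2 hx'
    rw [Prod.snd_sub, hx, Pi.sub_apply, h1, h2, ← mul_sub,
      deriv_fun_sub (hv.differentiableAt x hx') (hw.differentiableAt x hx')]

/-- Makes the difference of two solutions at a fixed time an admissible test pair. -/
theorem sub_mem_weightedSobolev {β : ℝ} {p q : L2 × L2} (hp : p ∈ weightedSobolev β)
    (hq : q ∈ weightedSobolev β) : p - q ∈ weightedSobolev β :=
  map_mem_closure₂ continuous_sub hp hq fun _ h₁ _ h₂ => sub_mem_domainGraph h₁ h₂

/-- Weak solutions are unique: test the equation at the time where `‖u₁ - u₂‖` is largest with the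
value of `u₁ - u₂` at that time. -/
theorem IsWeakSolution.eqOn {α θ β a T : ℝ} (hα : α ∈ Ioo (0 : ℝ) 1) (hθ : θ < 1)
    (ha : 0 ≤ a) (haT : a < T) {f : ℝ → L2} {φ : L2} {u₁ u₂ : ℝ → L2}
    (h₁ : IsWeakSolution α θ β a T f φ u₁) (h₂ : IsWeakSolution α θ β a T f φ u₂) :
    EqOn u₁ u₂ (Icc a T) := by
  have hinit : u₁ a = u₂ a := (eq_of_tendsto_right haT h₁.continuousOn h₁.initial).trans
    (eq_of_tendsto_right haT h₂.continuousOn h₂.initial).symm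
  obtain ⟨d₁, -, hW₁, hd₁, -, -, hweak₁⟩ := h₁.weak
  obtain ⟨d₂, -, hW₂, hd₂, -, -, hweak₂⟩ := h₂.weak
  obtain ⟨t₀, ht₀, hmax⟩ := isCompact_Icc.exists_isMaxOn (nonempty_Icc.2 haT.le)
    (h₁.continuousOn.sub h₂.continuousOn).norm
  have hmax' : ∀ t ∈ Icc a T, ‖u₁ t - u₂ t‖ ≤ ‖u₁ t₀ - u₂ t₀‖ := fun t ht => hmax ht
  by_contra hne
  have hpos : 0 < ‖u₁ t₀ - u₂ t₀‖ := by
    simp only [EqOn, not_forall] at hne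
    obtain ⟨t, ht, h⟩ := hne
    exact (norm_pos_iff.2 (sub_ne_zero.2 h)).trans_le (hmax' t ht)
  have hta : t₀ ≠ a := by
    rintro rfl
    simp [hinit] at hpos
  have ht₀' : t₀ ∈ Ioc a T := ⟨lt_of_le_of_ne ht₀.1 hta.symm, ht₀.2⟩
  set ω : L2 × L2 := (u₁ t₀, d₁ t₀) - (u₂ t₀, d₂ t₀) with hω
  have hωW : ω ∈ weightedSobolev β := sub_mem_weightedSobolev (hW₁ t₀ ht₀') (hW₂ t₀ ht₀')
  have hω1 : ω.1 = u₁ t₀ - u₂ t₀ := rfl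
  have hω2 : ω.2 = d₁ t₀ - d₂ t₀ := rfl
  obtain ⟨hH₁, he₁⟩ := hweak₁ ω hωW
  obtain ⟨hH₂, he₂⟩ := hweak₂ ω hωW
  have hself : inner ℝ (u₁ t₀) ω.1 - inner ℝ (u₂ t₀) ω.1 =
      ‖u₁ t₀ - u₂ t₀‖ * ‖u₁ t₀ - u₂ t₀‖ := by
    rw [← inner_sub_left, hω1, real_inner_self_eq_norm_mul_norm]
  -- Subtracting the equations removes `f`, so the time derivative of the pairing inherits the
  -- continuity of `d₁ - d₂` that the extremum principle needs.
  have hdiff : ∀ t ∈ Ioc a T, caputoHyperBessel α θ a T (fun s => inner ℝ (u₁ s) ω.1) t -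
      caputoHyperBessel α θ a T (fun s => inner ℝ (u₂ s) ω.1) t =
      -inner ℝ (d₁ t - d₂ t) ω.2 := fun t ht => by
    rw [inner_sub_left]
    linarith [he₁ t ht, he₂ t ht]
  have hlt := caputo_lt_of_isMax hα hθ ha haT hH₁ hH₂
    (h₁.continuousOn.inner continuousOn_const) (h₂.continuousOn.inner continuousOn_const)
    (by rw [hinit])
    (((hd₁.sub hd₂).inner continuousOn_const).neg.congr hdiff) ht₀'
    (fun t ht => by
      rw [hself, ← inner_sub_left]
      exact (real_inner_le_norm _ _).trans
        (mul_le_mul_of_nonneg_right (hmax' t ht) (norm_nonneg _)))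
    (by rw [← sub_pos, hself]; exact mul_pos hpos hpos)
  have h := hdiff t₀ ht₀'
  rw [← hω2] at h
  linarith [real_inner_self_nonneg (x := ω.2)]

end DegenerateFractional

theorem mainTheorem6 (α θ β a T : ℝ) (hα : α ∈ Set.Ioo (0 : ℝ) 1) (hθ : θ < 1) (ha : 0 ≤ a)
    (haT : a < T) :
    (β ∈ Set.Ioo (0 : ℝ) 1 →
      ∀ (f : ℝ → ℝ → ℝ) (φ : ℝ → ℝ) (u₁ u₂ : ℝ → ℝ → ℝ),
        DegenerateFractional.IsClassicalSolution α θ β a T f φ u₁ →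
        DegenerateFractional.IsClassicalSolution α θ β a T f φ u₂ →
        ∀ x ∈ Set.Icc (0 : ℝ) 1, ∀ t ∈ Set.Icc a T, u₁ x t = u₂ x t) ∧
    (β ∈ Set.Ioo (1 : ℝ) 2 →
      ∀ (f : ℝ → DegenerateFractional.L2) (φ : DegenerateFractional.L2)
        (u₁ u₂ : ℝ → DegenerateFractional.L2),
        DegenerateFractional.IsWeakSolution α θ β a T f φ u₁ →
        DegenerateFractional.IsWeakSolution α θ β a T f φ u₂ →
        ∀ t ∈ Set.Icc a T, u₁ t = u₂ t) := by
  constructor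
  · intro hβ f φ u₁ u₂ h₁ h₂ x hx t ht
    exact le_antisymm (h₁.le hα hθ ha haT hβ.2 h₂ hx ht) (h₂.le hα hθ ha haT hβ.2 h₁ hx ht)
  · intro _ f φ u₁ u₂ h₁ h₂ t ht
    exact h₁.eqOn hα hθ ha haT h₂ ht
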